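/- Let $R$ be an associative ring with identity; modules are unital. For right $R$-modules $M$ and $N$, say that $M$ is $N$-subprojective if for every epimorphism $g\colon B\to N$ of right $R$-modules and every homomorphism $f\colon M\to N$ there is a homomorphism $h\colon M\to B$ with $gh=f$. The subprojectivity domain of $M$ is the class of all right $R$-modules $N$ such that $M$ is $N$-subprojective. The ring $R$ is right perfect if every right $R$-module $M$ has a projective cover, that is, an epimorphism $g\colon P\to M$ with $P$ projective and $\ker g$ superfluous in $P$ ($\ker g+L=P$ implies $L=P$ for every submodule $L\subseteq P$). It is left coherent if every finitely generated left ideal of $R$ is finitely presented. Proposition. The following are equivalent: 1. $R$ is right perfect and left coherent. 2. For every right $R$-module $M$, the subprojectivity domain of $M$ is closed under arbitrary direct products. -/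

import Mathlib

universe u

/- Right modules over a ring `R` are modules over the opposite ring `Rᵐᵒᵖ`. -/

/-- For right `R`-modules `M` and `N`: `M` is `N`-subprojective if every homomorphism `M → N`
lifts along every epimorphism `B → N` of right `R`-modules. -/
def IsSubprojective (R : Type u) [Ring R]
    (M : Type u) [AddCommGroup M] [Module Rᵐᵒᵖ M]
    (N : Type u) [AddCommGroup N] [Module Rᵐᵒᵖ N] : Prop :=
  ∀ (B : Type u) [AddCommGroup B] [Module Rᵐᵒᵖ B] (g : B →ₗ[Rᵐᵒᵖ] N),
    Function.Surjective g →
      ∀ f : M →ₗ[Rᵐᵒᵖ] N, ∃ h : M →ₗ[Rᵐᵒᵖ] B, g ∘ₗ h = f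

/-- The subprojectivity domain of a right `R`-module `M`, as a class of right `R`-modules. -/
def subprojectivityDomain (R : Type u) [Ring R]
    (M : Type u) [AddCommGroup M] [Module Rᵐᵒᵖ M] : Set (ModuleCat.{u} Rᵐᵒᵖ) :=
  {N | IsSubprojective R M N}

/-- A class of right `R`-modules is closed under arbitrary direct products. -/
def ClosedUnderProducts (R : Type u) [Ring R] (C : Set (ModuleCat.{u} Rᵐᵒᵖ)) : Prop :=
  ∀ (ι : Type u) (N : ι → ModuleCat.{u} Rᵐᵒᵖ),
    (∀ i, N i ∈ C) → ModuleCat.of Rᵐᵒᵖ (∀ i, N i) ∈ C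

/-- A submodule `K` of `P` is superfluous if `K + L = P` implies `L = P`. -/
def IsSuperfluous {S P : Type u} [Ring S] [AddCommGroup P] [Module S P]
    (K : Submodule S P) : Prop :=
  ∀ L : Submodule S P, K ⊔ L = ⊤ → L = ⊤

/-- A projective cover of `M`: a projective module `P` with an epimorphism `g : P → M` whose
kernel is superfluous. -/
def IsProjectiveCover {S P M : Type u} [Ring S] [AddCommGroup P] [Module S P]
    [AddCommGroup M] [Module S M] (g : P →ₗ[S] M) : Prop :=
  Module.Projective S P ∧ Function.Surjective g ∧ IsSuperfluous (LinearMap.ker g)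

/-- `R` is right perfect if every right `R`-module has a projective cover. -/
def IsRightPerfect (R : Type u) [Ring R] : Prop :=
  ∀ (M : Type u) [AddCommGroup M] [Module Rᵐᵒᵖ M],
    ∃ (P : Type u) (_ : AddCommGroup P) (_ : Module Rᵐᵒᵖ P) (g : P →ₗ[Rᵐᵒᵖ] M),
      IsProjectiveCover g

/-- `R` is left coherent if every finitely generated left ideal is finitely presented as a left
`R`-module (over a noncommutative ring, `Ideal R` is the type of left ideals). -/
def IsLeftCoherent (R : Type u) [Ring R] : Prop :=
  ∀ I : Ideal R, I.FG → Module.FinitePresentation R I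

/-! Both conditions say that products of projective right `R`-modules are projective. A projective
module lies in every subprojectivity domain, so closure makes the identity of a product of
projectives lift along any epimorphism onto it; conversely, maps into a product lift through the
product of free covers.

Put `S = Rᵐᵒᵖ`. If products of projectives are projective, Chase's lemma and a cardinality count
give the descending chain condition on principal right ideals of `S`. By Bass's argument, `S/J` is
then semisimple, idempotents lift modulo `J`, and `JM` is superfluous in `M`, which yields
projective covers. Dual bases give coherence.

Conversely, coherence makes the solutions of each linear equation finitely generated, a property
inherited by projectives and their products. Hence each kernel element of a projective cover of such
a product is fixed by an endomorphism with image in the superfluous kernel, and so is zero. -/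

/-- The descending chain condition on principal right ideals `a S`, stated in terms of
divisibility: `a ∣ b` means `b S ⊆ a S`. -/
def PrincipalRightDCC (S : Type u) [Ring S] : Prop :=
  ∀ p : ℕ → S, (∀ n, p n ∣ p (n + 1)) → ∃ n, p (n + 1) ∣ p n

namespace PrincipalRightDCC

variable {S T : Type u} [Ring S] [Ring T]

/-- In a nonempty set of elements some principal right ideal is minimal. -/
theorem exists_minimal (h : PrincipalRightDCC S) {A : Set S} (hA : A.Nonempty) :
    ∃ z ∈ A, ∀ w ∈ A, z ∣ w → w ∣ z := by
  by_contra! hc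
  choose! next hmem hdvd hndvd using hc
  obtain ⟨a, ha⟩ := hA
  let p : ℕ → S := fun n => next^[n] a
  have hp : ∀ n, p n ∈ A := fun n => by
    induction n with
    | zero => exact ha
    | succ n ih => simpa only [p, Function.iterate_succ_apply'] using hmem _ ih
  have hs : ∀ n, p (n + 1) = next (p n) := fun n => Function.iterate_succ_apply' next n a
  obtain ⟨n, hn⟩ := h p fun n => by rw [hs]; exact hdvd _ (hp n)
  rw [hs] at hn
  exact hndvd _ (hp n) hn

theorem of_surjective (h : PrincipalRightDCC S) (f : S →+* T) (hf : Function.Surjective f) :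
    PrincipalRightDCC T := by
  intro p hp
  choose c hc using hp
  choose g hg using hf
  let q : ℕ → S := fun n => Nat.rec (g (p 0)) (fun n x => x * g (c n)) n
  have hq : ∀ n, f (q n) = p n := fun n => by
    induction n with
    | zero => exact hg _
    | succ n ih => rw [hc, ← ih, ← hg (c n), ← map_mul]
  obtain ⟨n, hn⟩ := h q fun n => ⟨g (c n), rfl⟩
  exact ⟨n, by rw [← hq, ← hq]; exact map_dvd f hn⟩

end PrincipalRightDCC

/-! ### Semisimplicity when the radical vanishes -/

section Semisimple

variable {T : Type u} [Ring T]

/-- A ring with zero Jacobson radical is semiprime. -/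
theorem exists_mul_mul_ne_zero (hJ : Ring.jacobson T = ⊥) {z : T} (hz : z ≠ 0) :
    ∃ s, z * s * z ≠ 0 := by
  by_contra! hc
  apply hz
  rw [← Ideal.mem_bot, ← hJ, ← Ideal.jacobson_bot, Ideal.mem_jacobson_iff]
  intro y
  refine ⟨1 - y * z, ?_⟩
  have : (1 - y * z) * y * z + (1 - y * z) - 1 = - (y * (z * y * z)) := by noncomm_ring
  rw [this, hc]
  simp

/-- Over a semiprime ring with the descending chain condition on principal right ideals,
every nonzero right ideal contains a nonzero idempotent. -/
theorem exists_idempotent_mul_left (h : PrincipalRightDCC T) (hJ : Ring.jacobson T = ⊥) {x : T}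
    (hx : x ≠ 0) : ∃ w, IsIdempotentElem (x * w) ∧ x * w ≠ 0 := by
  obtain ⟨z, ⟨⟨y, rfl⟩, hz⟩, hmin⟩ :=
    h.exists_minimal (A := {z | x ∣ z ∧ z ≠ 0}) ⟨x, dvd_rfl, hx⟩
  obtain ⟨s, hs⟩ := exists_mul_mul_ne_zero hJ hz
  obtain ⟨u, hu⟩ := hmin (x * y * s * (x * y))
    ⟨by simp only [mul_assoc]; exact dvd_mul_right _ _, hs⟩
    (by rw [mul_assoc]; exact dvd_mul_right _ _)
  set z := x * y with hzdef
  -- `z * u * s` is a right identity for `z * s`, so its idempotency defect lies in `zS` and is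
  -- killed by `z * s`. A nonzero defect would generate `zS` by minimality, forcing `z * s * z = 0`.
  have hab : z * s * (z * u * s) = z * s := by
    calc z * s * (z * u * s) = (z * s * z * u) * s := by noncomm_ring
      _ = z * s := by rw [← hu]
  have hid : z * u * s * (z * u * s) - z * u * s = 0 := by
    by_contra hne
    have hd : z ∣ z * u * s * (z * u * s) - z * u * s :=
      ⟨u * s * (z * u * s) - u * s, by noncomm_ring⟩
    obtain ⟨v, hv⟩ := hmin _ ⟨(dvd_mul_right x y).trans hd, hne⟩ hd
    apply hs
    calc z * s * z = z * s * ((z * u * s * (z * u * s) - z * u * s) * v) := by rw [← hv]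
      _ = 0 := by rw [← mul_assoc, mul_sub, ← mul_assoc (z * s), hab, hab, sub_self, zero_mul]
  refine ⟨y * u * s, ?_, ?_⟩
  · have : x * (y * u * s) = z * u * s := by simp only [hzdef, mul_assoc]
    rw [this]
    exact sub_eq_zero.mp hid
  · have : x * (y * u * s) = z * u * s := by simp only [hzdef, mul_assoc]
    rw [this]
    intro h0
    rw [h0, mul_zero] at hab
    exact hs (by rw [← hab, zero_mul])

theorem exists_idempotent_mul_right (h : PrincipalRightDCC T) (hJ : Ring.jacobson T = ⊥) {x : T}
    (hx : x ≠ 0) : ∃ w, IsIdempotentElem (w * x) ∧ w * x ≠ 0 := by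
  obtain ⟨w, hw, hne⟩ := exists_idempotent_mul_left h hJ hx
  have hw' : x * w * (x * w) = x * w := hw
  refine ⟨w * (x * w), ?_, fun h0 => hne ?_⟩
  · calc w * (x * w) * x * (w * (x * w) * x) = w * ((x * w) * (x * w) * (x * w)) * x := by
          noncomm_ring
      _ = w * (x * w) * x := by rw [hw', hw']
  · calc x * w = (x * w) * (x * w) * (x * w) := by rw [hw', hw']
      _ = x * (w * (x * w) * x) * w := by noncomm_ring
      _ = 0 := by rw [h0, mul_zero, zero_mul]

/-- Each left ideal `I` is `Te` for an idempotent `e ∈ I` with `(1 - e)T` minimal: if `x ≠ xe` in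
`I`, an idempotent multiple `f` of `x - xe` enlarges `e` to `e + f - ef`, contradicting minimality.
-/
theorem isSemisimpleRing_of_principalRightDCC (h : PrincipalRightDCC T)
    (hJ : Ring.jacobson T = ⊥) : IsSemisimpleRing T := by
  suffices hI : ∀ I : Ideal T, ∃ e ∈ I, ∀ x ∈ I, x * e = x by
    refine (isSemisimpleModule_iff T T).2 ⟨fun (I : Ideal T) => ?_⟩
    obtain ⟨e, he, hIe⟩ := hI I
    refine ⟨LinearMap.ker (LinearMap.toSpanSingleton T T e), isCompl_iff.2 ⟨?_, ?_⟩⟩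
    · rw [Submodule.disjoint_def]
      intro x hx hxe
      rw [← hIe x hx]
      simpa using hxe
    · rw [codisjoint_iff, eq_top_iff]
      intro x _
      have : x = x * e + (x - x * e) := by abel
      rw [this]
      refine Submodule.add_mem_sup (I.mul_mem_left x he) ?_
      simp [sub_mul, mul_assoc, hIe e he]
  intro I
  obtain ⟨_, ⟨e, heI, he, rfl⟩, hmin⟩ := h.exists_minimal
    (A := {z | ∃ e ∈ I, IsIdempotentElem e ∧ z = 1 - e}) ⟨1, 0, I.zero_mem, .zero, by simp⟩
  refine ⟨e, heI, fun x hx => ?_⟩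
  by_contra hne
  obtain ⟨w, hf, hf0⟩ := exists_idempotent_mul_right h hJ
    (x := x - x * e) (sub_ne_zero.2 (Ne.symm hne))
  have hfe : w * (x - x * e) * e = 0 := by
    rw [mul_assoc, sub_mul, mul_assoc, he.eq, sub_self, mul_zero]
  have hfI : w * (x - x * e) ∈ I :=
    I.mul_mem_left _ (I.sub_mem hx (I.mul_mem_left _ heI))
  generalize w * (x - x * e) = f at *
  have hprod : 1 - (e + f - e * f) = (1 - e) * (1 - f) := by noncomm_ring
  have hidem : IsIdempotentElem (e + f - e * f) := by
    have h1 : (e + f - e * f) * (e + f - e * f) =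
      e * e + e * f - e * e * f + (f * e) + f * f - f * e * f - e * (f * e) - e * (f * f)
        + e * (f * e) * f := by noncomm_ring
    rw [IsIdempotentElem, h1, hfe, he.eq, hf.eq]
    noncomm_ring
  obtain ⟨t, ht⟩ := hmin _ ⟨_, I.sub_mem (I.add_mem heI hfI) (I.mul_mem_left _ hfI), hidem, rfl⟩
    ⟨1 - f, hprod⟩
  apply hf0
  calc f = f * (1 - e) := by rw [mul_sub, hfe, mul_one, sub_zero]
    _ = f * ((1 - e) * (1 - f) * t) := by rw [← hprod, ← ht]
    _ = f * (1 - e) * (1 - f) * t := by simp only [mul_assoc]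
    _ = (f - f * e - (f * f - f * e * f)) * t := by noncomm_ring
    _ = 0 := by rw [hfe, hf.eq]; simp

end Semisimple

/-! ### Bass: projective covers from the chain condition -/

namespace PrincipalRightDCC

variable {S : Type u} [Ring S]

/-- If `a = a * j * t` with `j` in the Jacobson radical, then `1 - j * t` is a unit, so `a = 0`. -/
theorem eq_zero_of_mul_eq {a j t : S} (hj : j ∈ Ring.jacobson S) (h : a = a * j * t) : a = 0 := by
  have hjt : -(j * t) ∈ Ring.jacobson S := neg_mem (Ideal.mul_mem_right t _ hj)
  have key : ∀ x ∈ Ring.jacobson S, ∃ z, z * (1 + x) = 1 := fun x hx => by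
    rw [← Ideal.jacobson_bot, Ideal.mem_jacobson_iff] at hx
    obtain ⟨z, hz⟩ := hx 1
    refine ⟨z, sub_eq_zero.1 ?_⟩
    rw [Ideal.mem_bot] at hz
    rw [← hz]
    noncomm_ring
  obtain ⟨z, hz⟩ := key _ hjt
  obtain ⟨z', hz'⟩ := key (z * (j * t)) ((Ring.jacobson S).mul_mem_left _
    (Ideal.mul_mem_right t _ hj))
  have hz1 : z = 1 + z * (j * t) := by
    rw [mul_add, mul_one, mul_neg, ← sub_eq_add_neg, sub_eq_iff_eq_add] at hz
    exact hz
  rw [← hz1] at hz'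
  have hzz : z' = 1 + -(j * t) := left_inv_eq_right_inv hz' hz
  have h1 : (1 + -(j * t)) * z = 1 := by rw [← hzz, hz']
  calc a = a * ((1 + -(j * t)) * z) := by rw [h1, mul_one]
    _ = (a - a * j * t) * z := by noncomm_ring
    _ = 0 := by rw [← h, sub_self, zero_mul]

theorem isNilpotent_of_mem_jacobson (h : PrincipalRightDCC S) {j : S} (hj : j ∈ Ring.jacobson S) :
    IsNilpotent j := by
  obtain ⟨n, t, ht⟩ := h (fun n => j ^ n) fun n => ⟨j, pow_succ j n⟩
  refine ⟨n, eq_zero_of_mul_eq hj (t := t) ?_⟩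
  rwa [← pow_succ]

section Module

variable {M : Type u} [AddCommGroup M] [Module S M]

/-- If `M = JM` and `xM ≠ 0`, then `xjM ≠ 0` for some `j ∈ J`. Iterating gives a chain of products
of radical elements, none killing `M`; where it stabilises the product is zero. -/
theorem subsingleton_of_jacobson_smul_top (h : PrincipalRightDCC S)
    (hM : Ring.jacobson S • (⊤ : Submodule S M) = ⊤) : Subsingleton M := by
  by_contra hne
  rw [not_subsingleton_iff_nontrivial] at hne
  have step : ∀ x : S, (∃ m : M, x • m ≠ 0) → ∃ j ∈ Ring.jacobson S, ∃ m : M, (x * j) • m ≠ 0 := by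
    rintro x ⟨m, hm⟩
    by_contra! hc
    have hmem : m ∈ Ring.jacobson S • (⊤ : Submodule S M) := by rw [hM]; exact Submodule.mem_top
    apply hm
    refine Submodule.smul_induction_on hmem (fun j hj n _ => ?_) fun a b ha hb => ?_
    · rw [smul_smul]; exact hc j hj n
    · rw [smul_add, ha, hb, add_zero]
  choose! g hg hgm using step
  let p : ℕ → S := fun n => (fun x => x * g x)^[n] 1
  have hs : ∀ n, p (n + 1) = p n * g (p n) := fun n => Function.iterate_succ_apply' _ n 1
  have hp : ∀ n, ∃ m : M, p n • m ≠ 0 := fun n => by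
    induction n with
    | zero =>
      obtain ⟨m, hm⟩ := exists_ne (0 : M)
      exact ⟨m, by simpa [p] using hm⟩
    | succ n ih => rw [hs]; exact hgm _ ih
  obtain ⟨n, t, ht⟩ := h p fun n => ⟨_, hs n⟩
  rw [hs] at ht
  obtain ⟨m, hm⟩ := hp n
  exact hm (by rw [eq_zero_of_mul_eq (hg _ (hp n)) ht, zero_smul])

theorem isSuperfluous_jacobson_smul_top (h : PrincipalRightDCC S) :
    IsSuperfluous (Ring.jacobson S • (⊤ : Submodule S M)) := by
  intro L hL
  rw [← Submodule.Quotient.subsingleton_iff]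
  apply h.subsingleton_of_jacobson_smul_top
  have hmap := congrArg (Submodule.map L.mkQ) hL
  rwa [Submodule.map_sup, Submodule.map_smul'', Submodule.mkQ_map_self, sup_bot_eq,
    Submodule.map_top, Submodule.range_mkQ] at hmap

end Module

theorem isSemisimpleRing_quotient (h : PrincipalRightDCC S) :
    IsSemisimpleRing (S ⧸ Ring.jacobson S) :=
  isSemisimpleRing_of_principalRightDCC
    (h.of_surjective (Ideal.Quotient.mk (Ring.jacobson S)) Ideal.Quotient.mk_surjective)
    (Ring.jacobson_quotient_jacobson S)

theorem isSemisimpleModule_of_jacobson_smul_eq_zero (h : PrincipalRightDCC S)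
    {M : Type u} [AddCommGroup M] [Module S M]
    (hM : ∀ j ∈ Ring.jacobson S, ∀ m : M, j • m = 0) : IsSemisimpleModule S M := by
  have ht : Module.IsTorsionBySet S M (Ring.jacobson S) := fun m j => hM j j.2 m
  have := h.isSemisimpleRing_quotient
  let _ := ht.module
  exact ht.isSemisimpleModule_iff.1 inferInstance

/-- Simple modules have projective covers, with kernel inside the Jacobson radical. -/
theorem exists_cover_of_isSimpleModule (h : PrincipalRightDCC S)
    (N : Type u) [AddCommGroup N] [Module S N] [IsSimpleModule S N] :
    ∃ (P : Type u) (_ : AddCommGroup P) (_ : Module S P) (g : P →ₗ[S] N),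
      Module.Projective S P ∧ Function.Surjective g ∧
        LinearMap.ker g ≤ Ring.jacobson S • (⊤ : Submodule S P) := by
  set J := Ring.jacobson S
  have := IsSimpleModule.nontrivial S N
  obtain ⟨n, hn⟩ := exists_ne (0 : N)
  let f := LinearMap.toSpanSingleton S N n
  have hf : J ≤ LinearMap.ker f := IsSemisimpleModule.jacobson_le_ker (R := S) (R₂ := S) (M := S) (M₂ := N) f
  have hss : IsSemisimpleModule S (S ⧸ J) := by
    refine h.isSemisimpleModule_of_jacobson_smul_eq_zero fun j hj m => ?_
    obtain ⟨m, rfl⟩ := Submodule.mkQ_surjective J m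
    rw [← map_smul, smul_eq_mul, Submodule.mkQ_apply, Submodule.Quotient.mk_eq_zero]
    exact Ideal.mul_mem_right _ _ hj
  have hfs : Function.Surjective (Submodule.liftQ J f hf) := fun y => by
    obtain ⟨x, hx⟩ := IsSimpleModule.toSpanSingleton_surjective S hn y
    exact ⟨Submodule.mkQ J x, hx⟩
  obtain ⟨σ, hσ⟩ := IsSemisimpleModule.lifting_property _ hfs LinearMap.id
  obtain ⟨a, ha⟩ := Ideal.Quotient.mk_surjective (σ n)
  have hσa : ∀ x : S, σ (x • n) = Ideal.Quotient.mk J (x * a) := fun x => by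
    rw [map_smul, ← ha]; rfl
  have han : a • n = n := by
    have := LinearMap.congr_fun hσ n
    rw [LinearMap.comp_apply, ← ha] at this
    exact this
  have hidem : IsIdempotentElem (Ideal.Quotient.mk J a) := by
    rw [IsIdempotentElem, ← map_mul, ← hσa, han, ha]
  -- `J` is nil, so idempotents lift; the cover of `N` is `Se`.
  obtain ⟨e, he, hea⟩ := exists_isIdempotentElem_eq_of_ker_isNilpotent (Ideal.Quotient.mk J)
    (fun x hx => h.isNilpotent_of_mem_jacobson (by simpa [Ideal.mk_ker] using hx))
    _ ⟨a, rfl⟩ hidem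
  have hσe : ∀ x : S, σ (x • n) = Ideal.Quotient.mk J (x * e) := fun x => by
    rw [hσa, map_mul, map_mul, hea]
  have hen : e • n = n := by
    have h1 := LinearMap.congr_fun hσ (e • n)
    have h2 := LinearMap.congr_fun hσ n
    rw [LinearMap.comp_apply] at h1 h2
    rw [hσe, he.eq, hea, ha] at h1
    rw [h2] at h1
    exact h1.symm
  let P : Submodule S S := S ∙ e
  let π : S →ₗ[S] P := (LinearMap.toSpanSingleton S S e).codRestrict P fun x => by
    exact Submodule.mem_span_singleton.2 ⟨x, rfl⟩
  have hP : ∀ x ∈ P, x * e = x := fun x hx => by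
    obtain ⟨y, rfl⟩ := Submodule.mem_span_singleton.1 hx
    rw [smul_eq_mul, mul_assoc, he.eq]
  refine ⟨P, inferInstance, inferInstance, f ∘ₗ P.subtype, ?_, ?_, ?_⟩
  · refine Module.Projective.of_split P.subtype π ?_
    ext x
    simpa [π] using hP x x.2
  · intro y
    obtain ⟨x, hx⟩ := IsSimpleModule.toSpanSingleton_surjective S hn y
    refine ⟨π x, ?_⟩
    simpa [π, f, mul_smul, hen] using hx
  · intro x hx
    have hx0 : (x : S) • n = 0 := by simpa [f] using hx
    have hxJ : (x : S) ∈ J := by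
      rw [← hP x x.2, ← Ideal.Quotient.eq_zero_iff_mem, ← hσe, hx0, map_zero]
    have : x = (x : S) • (⟨e, Submodule.mem_span_singleton_self e⟩ : P) :=
      Subtype.ext (hP x x.2).symm
    rw [this]
    exact Submodule.smul_mem_smul hxJ Submodule.mem_top

/-- A ring with the descending chain condition on principal right ideals is left perfect. -/
theorem exists_isProjectiveCover (h : PrincipalRightDCC S)
    (M : Type u) [AddCommGroup M] [Module S M] :
    ∃ (P : Type u) (_ : AddCommGroup P) (_ : Module S P) (g : P →ₗ[S] M),
      IsProjectiveCover g := by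
  classical
  set J := Ring.jacobson S
  let K : Submodule S M := J • ⊤
  have hss : IsSemisimpleModule S (M ⧸ K) := by
    refine h.isSemisimpleModule_of_jacobson_smul_eq_zero fun j hj m => ?_
    obtain ⟨m, rfl⟩ := Submodule.mkQ_surjective K m
    rw [← map_smul, Submodule.mkQ_apply, Submodule.Quotient.mk_eq_zero]
    exact Submodule.smul_mem_smul hj Submodule.mem_top
  obtain ⟨s, E, -, hs⟩ := IsSemisimpleModule.exists_linearEquiv_dfinsupp S (M ⧸ K)
  choose P instP instM g hproj hsurj hker using
    fun m : s => have := hs m; h.exists_cover_of_isSimpleModule m.1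
  let G : (Π₀ m : s, P m) →ₗ[S] M ⧸ K := E.symm.toLinearMap ∘ₗ DFinsupp.mapRange.linearMap g
  have hG : Function.Surjective G :=
    E.symm.surjective.comp ((DFinsupp.mapRange_surjective _ fun m => map_zero (g m)).2 hsurj)
  obtain ⟨H, hH⟩ := Module.projective_lifting_property K.mkQ G K.mkQ_surjective
  refine ⟨Π₀ m : s, P m, inferInstance, inferInstance, H, inferInstance, ?_, ?_⟩
  · rw [← LinearMap.range_eq_top]
    apply h.isSuperfluous_jacobson_smul_top
    rw [eq_top_iff]
    intro m _
    obtain ⟨x, hx⟩ := hG (K.mkQ m)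
    have hmem : m - H x ∈ K := by
      rw [← Submodule.Quotient.mk_eq_zero, ← Submodule.mkQ_apply, map_sub, ← hx, ← hH]
      simp
    rw [← sub_add_cancel m (H x)]
    exact Submodule.add_mem_sup hmem (LinearMap.mem_range_self H x)
  · intro L hL
    refine h.isSuperfluous_jacobson_smul_top L (top_le_iff.1 (hL.symm.le.trans
      (sup_le_sup_right (fun x hx => ?_) L)))
    have hGx : G x = 0 := by
      rw [← hH, LinearMap.comp_apply, LinearMap.mem_ker.1 hx, map_zero]
    have hgx : ∀ m, g m (x m) = 0 := fun m => by
      have : DFinsupp.mapRange.linearMap g x = 0 := E.symm.map_eq_zero_iff.1 hGx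
      simpa using DFunLike.congr_fun this m
    rw [← DFinsupp.sum_single (f := x)]
    refine Submodule.sum_mem _ fun m _ => ?_
    have h1 : DFinsupp.lsingle (R := S) m (x m) ∈
        Submodule.map (DFinsupp.lsingle m) (J • (⊤ : Submodule S (P m))) :=
      Submodule.mem_map_of_mem (hker m (LinearMap.mem_ker.2 (hgx m)))
    rw [Submodule.map_smul''] at h1
    exact (smul_mono_right J le_top : J • Submodule.map _ _ ≤ J • ⊤) h1

end PrincipalRightDCC

/-- Arbitrary direct products of projective `S`-modules are projective. -/
def ProductsOfProjectivesProjective (S : Type u) [Ring S] : Prop :=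
  ∀ (ι : Type u) (N : ι → Type u) [∀ i, AddCommGroup (N i)] [∀ i, Module S (N i)],
    (∀ i, Module.Projective S (N i)) → Module.Projective S (∀ i, N i)

/-! ### Chase: the chain condition from projective products -/

section Chase

variable {S : Type u} [Ring S]

/-- Chase's lemma: a homomorphism from a countable product to a direct sum is, far out in the
product and deep in a descending chain of principal right ideals, concentrated on finitely many
summands modulo the intersection of the chain. -/
theorem exists_forall_dvd_of_linearMap_finsupp {X I : Type u} (p : ℕ → S)
    (hp : ∀ n, p n ∣ p (n + 1)) (φ : (ℕ × X → S) →ₗ[S] (I →₀ S)) :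
    ∃ (n : ℕ) (F : Finset I), ∀ x : ℕ × X → S, (∀ c, c.1 < n → x c = 0) →
      ∀ i ∉ F, ∀ m, p m ∣ p n * φ x i := by
  classical
  by_contra! hc
  choose x hx i hi m hm using hc
  have hmono : ∀ {a b : ℕ}, a ≤ b → p a ∣ p b := fun {a b} hab => by
    induction hab with
    | refl => exact dvd_rfl
    | step _ ih => exact ih.trans (hp _)
  let next : ℕ × Finset I → ℕ × Finset I := fun s =>
    (max (m s.1 s.2) (s.1 + 1), s.2 ∪ (φ (p s.1 • x s.1 s.2)).support)
  let st : ℕ → ℕ × Finset I := fun k => next^[k] (0, ∅)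
  have hst : ∀ k, st (k + 1) = next (st k) := fun k => Function.iterate_succ_apply' next k _
  let N : ℕ → ℕ := fun k => (st k).1
  let y : ℕ → (ℕ × X → S) := fun k => p (N k) • x (st k).1 (st k).2
  let e : ℕ → I := fun k => i (st k).1 (st k).2
  have hN : ∀ k, N k < N (k + 1) := fun k => by
    simp only [N, hst, next]; omega
  have hNm : ∀ k, m (st k).1 (st k).2 ≤ N (k + 1) := fun k => by
    simp only [N, hst, next]; omega
  have hNmono : StrictMono N := strictMono_nat_of_lt_succ hN
  have hF : ∀ k, (st k).2 ∪ (φ (y k)).support ⊆ (st (k + 1)).2 := fun k => by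
    rw [hst]
  have hFmono : Monotone fun k => (st k).2 :=
    monotone_nat_of_le_succ fun k => Finset.subset_union_left.trans (hF k)
  have hy0 : ∀ k c, c.1 < k → y k c = 0 := fun k c hck => by
    have h0 : x (st k).1 (st k).2 c = 0 := hx _ _ c (hck.trans_le (hNmono.id_le k))
    simp only [y, Pi.smul_apply, h0, smul_zero]
  have hey : ∀ k, ¬ p (N (k + 1)) ∣ φ (y k) (e k) := fun k hd => by
    refine hm (st k).1 (st k).2 ((hmono (hNm k)).trans ?_)
    simpa [y, e] using hd
  have hyF : ∀ l k, l < k → (φ (y l)).support ⊆ (st k).2 := fun l k hlk =>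
    (Finset.subset_union_right.trans (hF l)).trans (hFmono hlk)
  have he0 : ∀ l k, l < k → φ (y l) (e k) = 0 := fun l k hlk => by
    by_contra hne
    exact hi (st k).1 (st k).2 (hyF l k hlk (Finsupp.mem_support_iff.2 hne))
  have heinj : Function.Injective e := by
    refine Function.Injective.of_lt_imp_ne fun l k hlk heq => hey l ?_
    rw [heq, he0 l k hlk]
    exact dvd_zero _
  -- The infinite sum of the `y k`, finite at each coordinate by `hy0`. Its image under `φ` is
  -- nonzero at every `e k`, so has infinite support.
  let Y : ℕ × X → S := fun c => ∑ k ∈ Finset.range (c.1 + 1), y k c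
  have hY : ∀ k, φ Y (e k) ≠ 0 := fun k hk => by
    have htail : ∀ c, p (N (k + 1)) ∣ Y c - ∑ l ∈ Finset.range (k + 1), y l c := fun c => by
      have h1 : Y c = ∑ l ∈ Finset.range (max (k + 1) (c.1 + 1)), y l c := by
        refine Finset.sum_subset (Finset.range_mono (le_max_right _ _)) fun l _ hl => hy0 l c ?_
        simp only [Finset.mem_range] at hl
        omega
      rw [h1, ← Finset.sum_Ico_eq_sub _ (le_max_left _ _)]
      refine Finset.dvd_sum fun l hl => ?_
      exact (hmono (hNmono.monotone (Finset.mem_Ico.1 hl).1)).trans (dvd_mul_right _ _)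
    choose w hw using htail
    have hYw : Y = ∑ l ∈ Finset.range k, y l + y k + p (N (k + 1)) • w := by
      ext c
      have := hw c
      rw [sub_eq_iff_eq_add', Finset.sum_range_succ] at this
      simpa using this
    rw [hYw, map_add, map_add, map_sum, map_smul φ (p (N (k + 1))) w, Finsupp.add_apply, Finsupp.add_apply,
      Finsupp.finsetSum_apply, Finset.sum_eq_zero fun l hl => he0 l k (Finset.mem_range.1 hl),
      zero_add] at hk
    apply hey k
    rw [eq_neg_of_add_eq_zero_left hk, dvd_neg, Finsupp.smul_apply, smul_eq_mul]
    exact dvd_mul_right _ _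
  exact Set.infinite_range_of_injective heinj ((φ Y).support.finite_toSet.subset (by
    rintro _ ⟨k, rfl⟩
    exact Finsupp.mem_support_iff.2 (hY k)))

/-- If products of projective left `S`-modules are projective, then `S` satisfies the descending
chain condition on principal right ideals. -/
theorem ProductsOfProjectivesProjective.principalRightDCC (h : ProductsOfProjectivesProjective S) :
    PrincipalRightDCC S := by
  classical
  intro p hp
  by_contra! hc
  have hproj : Module.Projective S (ℕ × List S → S) := h (ℕ × List S) _ fun _ => inferInstance
  obtain ⟨s, hs⟩ := hproj.out
  obtain ⟨n, F, hF⟩ := exists_forall_dvd_of_linearMap_finsupp p hp s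
  let x : Set (List S) → (ℕ × List S → S) := fun A c => if c.1 = n ∧ c.2 ∈ A then 1 else 0
  have hx : ∀ A c, c.1 < n → x A c = 0 := fun A c hcn => if_neg fun hh => hcn.ne hh.1
  -- Indexing by `List S` lets the coordinates on `F` encode a subset of `List S` as an element of
  -- `List S`; injectivity contradicts Cantor.
  refine Function.cantor_injective (fun A => F.toList.map (s (x A))) fun A B hAB => ?_
  have hAB' : ∀ i ∈ F, s (x A) i = s (x B) i := fun i hi =>
    List.map_inj_left.1 hAB i (Finset.mem_toList.2 hi)
  have hdvd : ∀ i m, p m ∣ p n * s (x A - x B) i := fun i m => by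
    by_cases hi : i ∈ F
    · rw [map_sub, Finsupp.sub_apply, hAB' i hi, sub_self, mul_zero]
      exact dvd_zero _
    · exact hF _ (fun c hcn => by rw [Pi.sub_apply, hx A c hcn, hx B c hcn, sub_zero]) i hi m
  have hcoord : ∀ c, p (n + 1) ∣ p n * (x A - x B) c := fun c => by
    rw [← hs (x A - x B), Finsupp.linearCombination_apply, Finsupp.sum, Finset.sum_apply,
      Finset.mul_sum]
    refine Finset.dvd_sum fun i _ => ?_
    rw [Pi.smul_apply, smul_eq_mul, ← mul_assoc]
    exact (hdvd i (n + 1)).mul_right _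
  ext l
  by_contra hl
  have := hcoord (n, l)
  apply hc n
  by_cases hA : l ∈ A <;> by_cases hB : l ∈ B <;> simp_all [x]

end Chase

/-! ### Subprojectivity and products of projectives -/

open MulOpposite

/-- Products of projectives are projective exactly when all subprojectivity domains are closed
under products. -/
theorem closedUnderProducts_iff (R : Type u) [Ring R] :
    (∀ (M : Type u) [AddCommGroup M] [Module Rᵐᵒᵖ M],
        ClosedUnderProducts R (subprojectivityDomain R M)) ↔
      ProductsOfProjectivesProjective Rᵐᵒᵖ := by
  constructor
  · intro h ι N _ _ hN
    have hmem := h (∀ i, N i) ι (fun i => ModuleCat.of Rᵐᵒᵖ (N i)) fun i B _ _ g hg f =>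
      Module.projective_lifting_property (h := hN i) g (P := N i) LinearMap.id hg |>.elim
        fun k hk => ⟨k ∘ₗ f, by rw [← LinearMap.comp_assoc, hk]; rfl⟩
    refine Module.Projective.of_lifting_property'' fun f hf => ?_
    exact hmem ((∀ i, N i) →₀ Rᵐᵒᵖ) f hf LinearMap.id
  · intro h M _ _ ι N hN B _ _ g hg f
    have hproj : Module.Projective Rᵐᵒᵖ (∀ i, N i →₀ Rᵐᵒᵖ) := h ι _ fun _ => inferInstance
    choose k hk using fun i => hN i (N i →₀ Rᵐᵒᵖ) (Finsupp.linearCombination Rᵐᵒᵖ id)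
      (Finsupp.linearCombination_id_surjective Rᵐᵒᵖ (N i)) (LinearMap.proj i ∘ₗ f)
    let q : (∀ i, N i →₀ Rᵐᵒᵖ) →ₗ[Rᵐᵒᵖ] (∀ i, N i) :=
      LinearMap.pi fun i => Finsupp.linearCombination Rᵐᵒᵖ id ∘ₗ LinearMap.proj i
    obtain ⟨l, hl⟩ := Module.projective_lifting_property g q hg
    refine ⟨l ∘ₗ LinearMap.pi k, ?_⟩
    rw [← LinearMap.comp_assoc, hl]
    refine LinearMap.ext fun x => funext fun i => ?_
    exact LinearMap.congr_fun (hk i) x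

/-! ### Linear relations and coherence -/

section Relations

variable {R : Type u} [Ring R] {ι : Type u} [Fintype ι]

/-- Every solution in `M` of the linear equation with coefficients `r` is a combination of the
solutions `a` in the ring. -/
def LiftsRelation (r : ι → R) {t : ℕ} (a : Fin t → ι → R) (M : Type u) [AddCommGroup M]
    [Module Rᵐᵒᵖ M] : Prop :=
  ∀ m : ι → M, ∑ i, op (r i) • m i = 0 → ∃ m' : Fin t → M, ∀ i, m i = ∑ j, op (a j i) • m' j

namespace LiftsRelation

variable {r : ι → R} {t : ℕ} {a : Fin t → ι → R}

theorem self (ha : LinearMap.ker (Fintype.linearCombination R r) ≤ Submodule.span R (Set.range a)) :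
    LiftsRelation r a Rᵐᵒᵖ := by
  intro m hm
  have hmem : (fun i => unop (m i)) ∈ LinearMap.ker (Fintype.linearCombination R r) := by
    rw [LinearMap.mem_ker, Fintype.linearCombination_apply]
    apply op_injective
    simpa using hm
  obtain ⟨c, hc⟩ := (Submodule.mem_span_range_iff_exists_fun R).1 (ha hmem)
  refine ⟨fun j => op (c j), fun i => unop_injective ?_⟩
  simpa using (congrFun hc i).symm

theorem pi {κ : Type u} {N : κ → Type u} [∀ k, AddCommGroup (N k)] [∀ k, Module Rᵐᵒᵖ (N k)]
    (h : ∀ k, LiftsRelation r a (N k)) : LiftsRelation r a (∀ k, N k) := by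
  intro m hm
  choose m' hm' using fun k => h k (fun i => m i k) (by simpa using congrFun hm k)
  exact ⟨fun j k => m' k j, fun i => funext fun k => by simpa using hm' k i⟩

theorem finsupp {N : Type u} [AddCommGroup N] [Module Rᵐᵒᵖ N] (h : LiftsRelation r a N)
    (κ : Type u) : LiftsRelation r a (κ →₀ N) := by
  classical
  intro m hm
  choose m' hm' using fun k => h (fun i => m i k) (by simpa using DFunLike.congr_fun hm k)
  let F : Finset κ := Finset.univ.biUnion fun i => (m i).support
  -- The chosen `m' k` need not vanish off the supports, hence the truncation to `F`.
  refine ⟨fun j => Finsupp.indicator F fun k _ => m' k j, fun i => Finsupp.ext fun k => ?_⟩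
  by_cases hk : k ∈ F
  · simpa [Finsupp.finsetSum_apply, Finsupp.indicator_apply, hk] using hm' k i
  · have : m i k = 0 := by
      by_contra hne
      exact hk (Finset.mem_biUnion.2 ⟨i, Finset.mem_univ i, Finsupp.mem_support_iff.2 hne⟩)
    simp [Finsupp.finsetSum_apply, Finsupp.indicator_apply, hk, this]

theorem of_retract {N P : Type u} [AddCommGroup N] [Module Rᵐᵒᵖ N] [AddCommGroup P]
    [Module Rᵐᵒᵖ P] (h : LiftsRelation r a N) (s : P →ₗ[Rᵐᵒᵖ] N) (q : N →ₗ[Rᵐᵒᵖ] P)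
    (hq : ∀ x, q (s x) = x) : LiftsRelation r a P := by
  intro m hm
  obtain ⟨m', hm'⟩ := h (fun i => s (m i)) (by simp only [← map_smul, ← map_sum, hm, map_zero])
  refine ⟨fun j => q (m' j), fun i => ?_⟩
  rw [← hq (m i), hm' i]
  simp

theorem of_projective
    (ha : LinearMap.ker (Fintype.linearCombination R r) ≤ Submodule.span R (Set.range a))
    (P : Type u) [AddCommGroup P] [Module Rᵐᵒᵖ P] [hP : Module.Projective Rᵐᵒᵖ P] :
    LiftsRelation r a P := by
  obtain ⟨s, hs⟩ := hP.out
  exact ((self ha).finsupp P).of_retract s _ hs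

end LiftsRelation

theorem IsLeftCoherent.exists_generators (h : IsLeftCoherent R) (r : ι → R) :
    ∃ (t : ℕ) (a : Fin t → ι → R),
      Submodule.span R (Set.range a) = LinearMap.ker (Fintype.linearCombination R r) := by
  rw [← Submodule.fg_iff_exists_fin_generating_family]
  have hfp : Module.FinitePresentation R (LinearMap.range (Fintype.linearCombination R r)) :=
    h _ (by rw [Fintype.range_linearCombination]; exact Submodule.fg_span (Set.finite_range r))
  rw [← LinearMap.ker_rangeRestrict]
  exact Module.FinitePresentation.fg_ker _ (LinearMap.surjective_rangeRestrict _)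

/-- An element of the kernel of a cover of a module that lifts relations is fixed by an
endomorphism of the cover with values in the kernel. -/
theorem exists_endomorphism_fixing {P M : Type u} [AddCommGroup P] [Module Rᵐᵒᵖ P]
    [hP : Module.Projective Rᵐᵒᵖ P] [AddCommGroup M] [Module Rᵐᵒᵖ M] (g : P →ₗ[Rᵐᵒᵖ] M)
    (hg : Function.Surjective g)
    (hM : ∀ (ι : Type u) [Fintype ι] (r : ι → R), ∃ (t : ℕ) (a : Fin t → ι → R),
      (∀ j, ∑ i, a j i * r i = 0) ∧ LiftsRelation r a M) (k : P) (hk : g k = 0) :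
    ∃ θ : P →ₗ[Rᵐᵒᵖ] P, g ∘ₗ θ = 0 ∧ θ k = k := by
  classical
  obtain ⟨s, hs⟩ := hP.out
  let F := (s k).support
  have hsum : ∀ (f : P → Rᵐᵒᵖ → P), (s k).sum f = ∑ x : F, f x (s k x) := fun f =>
    (Finset.sum_coe_sort F fun x => f x (s k x)).symm
  have hk' : ∑ x : F, s k x • (x : P) = k := by
    conv_rhs => rw [← hs k, Finsupp.linearCombination_apply, hsum]
    rfl
  obtain ⟨t, a, ha, hlift⟩ := hM F fun x => unop (s k x)
  obtain ⟨m', hm'⟩ := hlift (fun x => g x) (by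
    simp only [op_unop, ← map_smul, ← map_sum, hk', hk])
  choose p hp using fun j => hg (m' j)
  -- Each `x ∈ F` is corrected into `ker g`; the corrections cancel in the expansion of `k` because
  -- the `a j` are relations among its coefficients.
  let v : P → P := fun x => if hx : x ∈ F then x - ∑ j, op (a j ⟨x, hx⟩) • p j else 0
  have hgv : ∀ x, g (v x) = 0 := fun x => by
    by_cases hx : x ∈ F
    · have := hm' ⟨x, hx⟩
      simp only [v, dif_pos hx, map_sub, map_sum, map_smul, hp, this, sub_self]
    · simp [v, dif_neg hx]
  refine ⟨Finsupp.linearCombination Rᵐᵒᵖ v ∘ₗ s, ?_, ?_⟩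
  · ext x
    simp [Finsupp.linearCombination_apply, Finsupp.sum, hgv]
  · rw [LinearMap.comp_apply, Finsupp.linearCombination_apply, hsum]
    have hv : ∀ x : F, s k x • v x = s k x • (x : P) - ∑ j, op (a j x * unop (s k x)) • p j :=
      fun x => by
        simp only [v, dif_pos x.2, smul_sub, Finset.smul_sum, smul_smul, op_mul, op_unop]
    simp only [hv, Finset.sum_sub_distrib, hk']
    rw [Finset.sum_comm]
    simp only [← Finset.sum_smul, ← Finset.op_sum, ha]
    simp

/-- A superfluous submodule of a projective module contains no nonzero fixed points of
endomorphisms taking values in it. -/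
theorem IsSuperfluous.eq_zero_of_fixed {S P : Type u} [Ring S] [AddCommGroup P] [Module S P]
    [Module.Projective S P] {K : Submodule S P} (hK : IsSuperfluous K) (θ : P →ₗ[S] P)
    (hθ : ∀ x, θ x ∈ K) (k : P) (hk : θ k = k) : k = 0 := by
  have hsurj : LinearMap.range (LinearMap.id - θ) = ⊤ := hK _ <| by
    rw [eq_top_iff]
    intro x _
    have : x = θ x + (LinearMap.id - θ : P →ₗ[S] P) x := by simp
    rw [this]
    exact Submodule.add_mem_sup (hθ x) (LinearMap.mem_range_self _ x)
  -- `ker (1 - θ)` lies in `K`, so the section `σ` is onto as well, making `1 - θ` injective.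
  obtain ⟨σ, hσ⟩ := LinearMap.exists_rightInverse_of_surjective _ hsurj
  have hσ' : ∀ x, (LinearMap.id - θ : P →ₗ[S] P) (σ x) = x := LinearMap.congr_fun hσ
  have hrange : LinearMap.range σ = ⊤ := hK _ <| by
    rw [eq_top_iff]
    intro x _
    have hx : x = (x - σ ((LinearMap.id - θ : P →ₗ[S] P) x)) +
        σ ((LinearMap.id - θ : P →ₗ[S] P) x) := by abel
    rw [hx]
    refine Submodule.add_mem_sup ?_ (LinearMap.mem_range_self _ _)
    set y := x - σ ((LinearMap.id - θ : P →ₗ[S] P) x) with hy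
    have h0 : (LinearMap.id - θ : P →ₗ[S] P) y = 0 := by rw [hy, map_sub, hσ', sub_self]
    have : y = θ y := by simpa [sub_eq_zero] using h0
    rw [this]
    exact hθ y
  obtain ⟨z, rfl⟩ := LinearMap.range_eq_top.1 hrange k
  rw [← hσ' z]
  simp [hk]

theorem productsOfProjectivesProjective_of_perfect_of_coherent (hp : IsRightPerfect R)
    (hc : IsLeftCoherent R) : ProductsOfProjectivesProjective Rᵐᵒᵖ := by
  intro κ N _ _ hN
  obtain ⟨P, _, _, g, hP, hg, hK⟩ := hp (∀ i, N i)
  have hlift : ∀ (ι : Type u) [Fintype ι] (r : ι → R), ∃ (t : ℕ) (a : Fin t → ι → R),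
      (∀ j, ∑ i, a j i * r i = 0) ∧ LiftsRelation r a (∀ i, N i) := fun ι _ r => by
    obtain ⟨t, a, ha⟩ := hc.exists_generators r
    refine ⟨t, a, fun j => ?_, .pi fun i => .of_projective ha.ge _⟩
    have : a j ∈ LinearMap.ker (Fintype.linearCombination R r) :=
      ha ▸ Submodule.subset_span ⟨j, rfl⟩
    simpa [Fintype.linearCombination_apply] using this
  have hinj : Function.Injective g := by
    rw [injective_iff_map_eq_zero]
    intro k hk
    obtain ⟨θ, hθ, hθk⟩ := exists_endomorphism_fixing g hg hlift k hk
    exact hK.eq_zero_of_fixed θ (fun x => LinearMap.congr_fun hθ x) k hθk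
  exact .of_equiv' (LinearEquiv.ofBijective g ⟨hinj, hg⟩)

/-- The coordinate functions on the syzygy module `K` of `r` are finitely many elements of a
projective product. Their dual-basis coefficients give finitely many syzygies, and evaluating the
expansions at `a ∈ K` writes `a` in terms of them. -/
theorem ProductsOfProjectivesProjective.isLeftCoherent
    (h : ProductsOfProjectivesProjective Rᵐᵒᵖ) : IsLeftCoherent R := by
  classical
  intro I hI
  obtain ⟨n, r, rfl⟩ := Submodule.fg_iff_exists_fin_generating_family.1 hI
  rw [← Fintype.range_linearCombination]
  refine Module.finitePresentation_of_surjective _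
    (LinearMap.surjective_rangeRestrict (Fintype.linearCombination R r)) ?_
  rw [LinearMap.ker_rangeRestrict]
  set K := LinearMap.ker (Fintype.linearCombination R r)
  have hproj : Module.Projective Rᵐᵒᵖ (K → Rᵐᵒᵖ) := h K _ fun _ => inferInstance
  obtain ⟨s, hs⟩ := hproj.out
  let m : Fin n → (K → Rᵐᵒᵖ) := fun i a => op ((a : Fin n → R) i)
  have hm : ∑ i, op (r i) • m i = 0 := by
    ext a
    have := LinearMap.mem_ker.1 a.2
    rw [Fintype.linearCombination_apply] at this
    apply unop_injective
    simpa [m] using this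
  let F : Finset (K → Rᵐᵒᵖ) := Finset.univ.biUnion fun i => (s (m i)).support
  let b : (K → Rᵐᵒᵖ) → (Fin n → R) := fun x i => unop (s (m i) x)
  have hb : ∀ x, b x ∈ K := fun x => by
    have := DFunLike.congr_fun (congrArg s hm) x
    rw [LinearMap.mem_ker, Fintype.linearCombination_apply]
    apply op_injective
    simpa [b, map_sum, Finsupp.finsetSum_apply] using this
  refine ⟨F.image b, le_antisymm (Submodule.span_le.2 ?_) fun a ha => ?_⟩
  · intro y hy
    obtain ⟨x, -, rfl⟩ := Finset.mem_image.1 hy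
    exact hb x
  · have hsum : a = ∑ x ∈ F, unop (x ⟨a, ha⟩) • b x := by
      ext i
      have h1 := congrFun (hs (m i)) ⟨a, ha⟩
      rw [Finsupp.linearCombination_apply, Finsupp.sum_of_support_subset (s := F) _
        (Finset.subset_biUnion_of_mem (fun i => (s (m i)).support) (Finset.mem_univ i)) _
        (by simp)] at h1
      apply op_injective
      simpa [b, m] using h1.symm
    rw [hsum]
    exact Submodule.sum_mem _ fun x hx =>
      Submodule.smul_mem _ _ (Submodule.subset_span (Finset.mem_coe.2 (Finset.mem_image_of_mem b hx)))

end Relations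

theorem mainTheorem7 (R : Type u) [Ring R] :
    (∀ (M : Type u) [AddCommGroup M] [Module Rᵐᵒᵖ M],
        ClosedUnderProducts R (subprojectivityDomain R M)) ↔
      (IsRightPerfect R ∧ IsLeftCoherent R) := by
  rw [closedUnderProducts_iff]
  exact ⟨fun h => ⟨h.principalRightDCC.exists_isProjectiveCover, h.isLeftCoherent⟩,
    fun h => productsOfProjectivesProjective_of_perfect_of_coherent h.1 h.2⟩
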